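/- Let $n \ge 1$, let $\mathcal{C}_{2n}$ be the crown poset on $\{1,\dots,2n\}$ with cover relations $1 \prec 2 \succ 3 \prec \cdots \succ 2n-1 \prec 2n \succ 1$, and let $\mathcal{O}(\mathcal{C}_{2n}) = \{x \in [0,1]^{2n} : x_i \le x_j \text{ whenever } i \preceq j\}$ be its order polytope. Its $h^*$-polynomial is the polynomial $h^*(\mathcal{O}(\mathcal{C}_{2n}),t)$ of degree at most $2n = \dim \mathcal{O}(\mathcal{C}_{2n})$ with $$1+\sum_{k\ge 1} \#\bigl(k\,\mathcal{O}(\mathcal{C}_{2n})\cap\mathbb{Z}^{2n}\bigr)\,t^k = \frac{h^*(\mathcal{O}(\mathcal{C}_{2n}),t)}{(1-t)^{2n+1}} .$$ For a finite poset $P$ and an injection $\omega\colon P\to\mathbb{Z}$, a cover relation $x\prec y$ has sign $+1$ if $\omega(x)<\omega(y)$ and $-1$ otherwise. The labeled poset $(P,\omega)$ is sign-graded if the signs along every maximal chain have the same sum; its rank function $\rho$ then assigns to $x$ the sum of the signs along any saturated chain from a minimal element to $x$. It is canonically labeled if it is sign-graded, $\rho$ has values in $\{0,1\}$, and $\rho(x)<\rho(y)$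 implies $\omega(x)<\omega(y)$. The Jordan–Hölder set $\operatorname{JH}(P,\omega)$ is the set of words $\omega(x_1)\omega(x_2)\cdots\omega(x_p)$, where $x_1,\dots,x_p$ runs over the linear extensions of $P$. For a word $\pi=a_1\cdots a_p$ let $\operatorname{peak}(\pi)=\#\{1<i<p : a_{i-1}<a_i>a_{i+1}\}$. Let $\tilde{\mathcal{C}}_{2n}$ be the poset obtained from $\mathcal{C}_{2n}$ by adjoining a greatest element. **Theorem.** For each $n\ge 1$, the poset $\tilde{\mathcal{C}}_{2n}$ has a canonical labeling, and there are nonnegative integers $\gamma_{2n,0},\dots,\gamma_{2n,n-1}$ such that $$h^*(\mathcal{O}(\mathcal{C}_{2n}),t)=\sum_{0\le j\le n-1}\gamma_{2n,j}\,t^j(1+t)^{2n-2-2j},$$ that is, $h^*(\mathcal{O}(\mathcal{C}_{2n}),t)$ has a nonnegative expansion in the basis $\Gamma_{2n-2}=\{t^j(1+t)^{2n-2-2j}\}_{0\le j\le n-1}$; and, for every canonical labeling $\tilde\omega$ of $\tilde{\mathcal{C}}_{2n}$ and every $0\le j\le n-1$, $$\gamma_{2n,j}=2^{-2n+2+2j}\,\#\{\pi\in\operatorname{JH}(\tilde{\mathcal{C}}_{2n},\tilde\omega)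 : \operatorname{peak}(\pi)=j+1\}.$$ -/

import Mathlib

open scoped Pointwise

noncomputable section

/-! ### Ehrhart series and `h^*`-polynomials -/

/-- The lattice point counting function `k ↦ #(k𝔭 ∩ ℤ^ι)` of a bounded set `𝔭 ⊆ ℝ^ι`. -/
def ehrhartCount {ι : Type*} (p : Set (ι → ℝ)) (k : ℕ) : ℕ :=
  Set.ncard {z : ι → ℤ | (fun i => (z i : ℝ)) ∈ (k : ℝ) • p}

/-- The Ehrhart series `1 + ∑_{k ≥ 1} #(k𝔭 ∩ ℤ^ι) t^k`. -/
def ehrhartSeries {ι : Type*} (p : Set (ι → ℝ)) : PowerSeries ℤ :=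
  PowerSeries.mk fun k => if k = 0 then 1 else (ehrhartCount p k : ℤ)

/-- The dimension of (the affine hull of) a nonempty set `𝔭 ⊆ ℝ^ι`. -/
def polytopeDim {ι : Type*} (p : Set (ι → ℝ)) : ℕ :=
  Module.finrank ℝ (vectorSpan ℝ p)

/-- `h` is the `h^*`-polynomial of `𝔭`: with `d = dim 𝔭`, the degree of `h` is at most `d` and
`1 + ∑_{k ≥ 1} #(k𝔭 ∩ ℤ^ι) t^k = h(t) / (1 - t)^(d + 1)`. Such an `h` is unique. -/
def IsHStarPolynomial {ι : Type*} (p : Set (ι → ℝ)) (h : Polynomial ℤ) : Prop :=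
  h.natDegree ≤ polytopeDim p ∧
    ehrhartSeries p * (1 - PowerSeries.X) ^ (polytopeDim p + 1) = (h : PowerSeries ℤ)

/-- The order polytope `{x ∈ [0,1]^P | x_i ≤ x_j whenever i ≤ j in P}`. -/
def orderPolytope (P : Type*) [PartialOrder P] : Set (P → ℝ) :=
  {x | (∀ i, 0 ≤ x i ∧ x i ≤ 1) ∧ ∀ i j, i ≤ j → x i ≤ x j}

/-! ### Crown posets -/

/-- The ground set of the crown poset `𝒞_{2n}`; the element `i` of `{1, …, 2n}` is represented
by `i - 1`. -/
def Crown (n : ℕ) : Type := Fin (2 * n)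

instance (n : ℕ) : Fintype (Crown n) := inferInstanceAs (Fintype (Fin (2 * n)))

instance (n : ℕ) : DecidableEq (Crown n) := inferInstanceAs (DecidableEq (Fin (2 * n)))

/-- The position in `{0, …, 2n - 1}` of an element of the crown poset. -/
def Crown.pos {n : ℕ} (x : Crown n) : ℕ := Fin.val (n := 2 * n) x

/-- The strict relations `1 ≺ 2 ≻ 3 ≺ ⋯ ≻ 2n - 1 ≺ 2n ≻ 1` of the crown poset, in positions
counted from `0`: positions of even value are minimal, those of odd value are maximal, and
neighbours in the cyclic order are related. -/
def Crown.Rel {n : ℕ} (x y : Crown n) : Prop :=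
  Even x.pos ∧ Odd y.pos ∧
    (y.pos = x.pos + 1 ∨ x.pos = y.pos + 1 ∨ (x.pos = 0 ∧ y.pos = 2 * n - 1))

/-- The crown poset. Every chain has at most two elements, so that its order is the reflexive
closure of `Crown.Rel`. -/
instance (n : ℕ) : PartialOrder (Crown n) where
  le x y := x = y ∨ Crown.Rel x y
  le_refl x := Or.inl rfl
  le_trans x y z := by
    rintro (rfl | h) (rfl | h')
    · exact Or.inl rfl
    · exact Or.inr h'
    · exact Or.inr h
    · exact absurd h.2.1 (Nat.not_odd_iff_even.mpr h'.1)
  le_antisymm x y := by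
    rintro (rfl | h) (h' | h')
    · rfl
    · rfl
    · exact h'.symm
    · exact absurd h.2.1 (Nat.not_odd_iff_even.mpr h'.1)

/-! ### Labeled posets -/

/-- The sign of a pair of elements `x < y` of a labeled poset: `1` if `ω x < ω y`, and `-1`
otherwise. -/
def labelSign {P : Type*} (ω : P → ℤ) (x y : P) : ℤ := if ω x < ω y then 1 else -1

/-- `ρ` is the rank function of the sign-graded labeled poset `(P, ω)`: for every element `x`
and every saturated chain from a minimal element to `x` the signs of the cover relations of the
chain add up to `ρ x`, and `ρ` takes the same value (the rank of `(P, ω)`) at all maximal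
elements, that is, the signs along every maximal chain have the same sum. -/
def IsSignedRankFunction {P : Type*} [PartialOrder P] (ω ρ : P → ℤ) : Prop :=
  (∀ x, IsMin x → ρ x = 0) ∧
  (∀ x y, x ⋖ y → ρ y = ρ x + labelSign ω x y) ∧
  (∀ x y, IsMax x → IsMax y → ρ x = ρ y)

/-- `(P, ω)` is a canonically labeled poset: `ω` is injective, `(P, ω)` is sign-graded with a
rank function `ρ` that has values in `{0, 1}`, and `ρ x < ρ y` implies `ω x < ω y`. -/
def IsCanonicalLabeling {P : Type*} [PartialOrder P] (ω : P → ℤ) : Prop :=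
  Function.Injective ω ∧ ∃ ρ : P → ℤ, IsSignedRankFunction ω ρ ∧
    (∀ x, ρ x = 0 ∨ ρ x = 1) ∧ ∀ x y, ρ x < ρ y → ω x < ω y

/-- The Jordan–Hölder set `JH(P, ω)`: all words `ω(x_1) ω(x_2) ⋯ ω(x_p)`, where `x_1, …, x_p`
is a linear extension of `P`. -/
def jordanHolder {P : Type*} [Fintype P] [PartialOrder P] (ω : P → ℤ) :
    Set (Fin (Fintype.card P) → ℤ) :=
  {a | ∃ e : Fin (Fintype.card P) ≃ P, (∀ i j, e i ≤ e j → i ≤ j) ∧ ∀ i, a i = ω (e i)}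

/-- The number of peaks `a_{i-1} < a_i > a_{i+1}` of a word `a_1 ⋯ a_m`; the three indices are
consecutive positions `i, j, k` of the word. -/
def peak {m : ℕ} (a : Fin m → ℤ) : ℕ :=
  Set.ncard {j : Fin m | ∃ i k : Fin m, (i : ℕ) + 1 = j ∧ (j : ℕ) + 1 = k ∧
    a i < a j ∧ a k < a j}

end

/-! ### Divisibility in the basis `t^j (1 + t)^(e j)` -/

/-! The proof counts, in two ways, the enriched partitions with values below `2 * m` of the crown
with a greatest element adjoined. In an enriched partition, equal values must be met with increasing
labels if the value is odd and with decreasing labels if it is even.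

Sorting by value and signed label splits the enriched partitions of any injectively labeled poset
over its linear extensions (`card_enrichedPartition`). For a single word with `q + 1` letters and
`j` peaks, the generating function in `m` is `2t (4t)^j (1+t)^(q-2j) / (1-t)^(q+2)`, which depends
only on `j` (`chainSeries_eq`).

For a canonical labeling of the crown with top, the parity conditions decouple: pairing consecutive
values, with the pairs offset by one at the odd positions, identifies an enriched partition with one
free bit per element and an order preserving map into `{0, …, k}`, where `k` is read off from the
value at the top (`enrichedCount_crown`). Up to `2^(2n+1)` and partial summation this is the Ehrhart
series of the order polytope.

Equating the counts and cancelling `2t` gives `4^n t h^*(t) = ∑ N_j (4t)^j (1+t)^(2n-2j)`, with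
`N_j` the number of words with `j` peaks. At `t = 0` this forces `N_0 = 0`, so a second `t` cancels.
The polynomials `t^j (1+t)^(e j)` are unitriangular in the monomials, so `4^n` divides each `N_(j+1)
4^(j+1)`, and these numbers are the same for all canonical labelings. -/

theorem dvd_of_forall_dvd_coeff_sum {n : ℕ} (c : ℕ → ℤ) (e : ℕ → ℕ) (d : ℤ)
    (h : ∀ k, d ∣ (∑ j ∈ Finset.range n, Polynomial.C (c j) * Polynomial.X ^ j *
      (1 + Polynomial.X) ^ e j).coeff k) :
    ∀ j < n, d ∣ c j := by
  intro j
  induction j using Nat.strong_induction_on with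
  | _ j ih =>
    intro hj
    have hk := h j
    rw [Polynomial.finsetSum_coeff,
      ← Finset.add_sum_erase _ _ (Finset.mem_range.mpr hj)] at hk
    -- In the coefficient of `X ^ j`, terms with index above `j` vanish, those below are divisible
    -- by induction, and the term `j` contributes exactly `c j`. With `d = 0` this is linear
    -- independence.
    have hrest : d ∣ ∑ i ∈ (Finset.range n).erase j, (Polynomial.C (c i) * Polynomial.X ^ i *
        (1 + Polynomial.X) ^ e i).coeff j := by
      refine Finset.dvd_sum fun i hi => ?_
      rw [Finset.mem_erase, Finset.mem_range] at hi
      rw [mul_assoc, Polynomial.coeff_C_mul, Polynomial.coeff_X_pow_mul']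
      split_ifs with hij
      · exact Dvd.dvd.mul_right (ih i (lt_of_le_of_ne hij hi.1) hi.2) _
      · simp
    have hself : (Polynomial.C (c j) * Polynomial.X ^ j *
        (1 + Polynomial.X) ^ e j).coeff j = c j := by
      rw [mul_assoc, Polynomial.coeff_C_mul, Polynomial.coeff_X_pow_mul', if_pos le_rfl,
        Nat.sub_self, Polynomial.coeff_zero_eq_eval_zero]
      simp
    rw [hself] at hk
    exact (dvd_add_left hrest).mp hk

/-! ### Enriched chains -/

/-- The sorting key of a letter `s` with value `c`: letters with equal value increase if the value
is odd, and decrease if it is even. -/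
def enrichedKey (c : ℕ) (s : ℤ) : ℕ ×ₗ ℤ := toLex (c, if Even c then -s else s)

theorem enrichedKey_lt_iff {c c' : ℕ} {s s' : ℤ} :
    enrichedKey c s < enrichedKey c' s' ↔
      c < c' ∨ (c = c' ∧ ((Even c ∧ s' < s) ∨ (¬ Even c ∧ s < s'))) := by
  unfold enrichedKey
  rw [Prod.Lex.toLex_lt_toLex]
  refine or_congr Iff.rfl (and_congr_right fun h => ?_)
  change c = c' at h
  subst h
  by_cases hc : Even c <;> simp [hc]

theorem enrichedKey_injective {P : Type*} {ω : P → ℤ} (hω : Function.Injective ω) (f : P → ℕ) :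
    Function.Injective fun x => enrichedKey (f x) (ω x) := by
  intro x y h
  have h' := toLex.injective h
  rw [Prod.mk.injEq] at h'
  obtain ⟨h1, h2⟩ := h'
  rw [h1] at h2
  apply hω
  split_ifs at h2 <;> omega

/-- The number of enriched chains of values on the letters `a 0, …, a i` that end in `c`. -/
def chainCount (a : ℕ → ℤ) : ℕ → ℕ → ℕ
  | 0, _ => 1
  | i + 1, c => ∑ b ∈ Finset.range c, chainCount a i b +
      if (Even c ∧ a (i + 1) < a i) ∨ (¬ Even c ∧ a i < a (i + 1)) then chainCount a i c else 0

/-- The number of peaks of the word `a 0, …, a i`. -/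
def peakCount (a : ℕ → ℤ) (i : ℕ) : ℕ :=
  ((Finset.range (i - 1)).filter fun j => a j < a (j + 1) ∧ a (j + 2) < a (j + 1)).card

theorem peakCount_add_two (a : ℕ → ℤ) (i : ℕ) :
    peakCount a (i + 2) = peakCount a (i + 1) +
      if a i < a (i + 1) ∧ a (i + 2) < a (i + 1) then 1 else 0 := by
  simp only [peakCount, Nat.add_sub_cancel, show i + 2 - 1 = i + 1 from rfl]
  rw [Finset.range_add_one, Finset.filter_insert]
  split_ifs with h
  · rw [Finset.card_insert_of_notMem (by simp)]
  · rfl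

/-! ### Generating functions of enriched chains -/

open PowerSeries in
theorem mk_sum_range_two_mul (u : ℕ → ℤ) :
    (PowerSeries.mk fun m => ∑ b ∈ Finset.range (2 * m), u b) * (1 - X) =
      X * ((PowerSeries.mk fun m => u (2 * m)) + PowerSeries.mk fun m => u (2 * m + 1)) := by
  ext m
  rw [mul_sub, mul_one, map_sub]
  cases m with
  | zero => simp
  | succ m =>
    rw [PowerSeries.coeff_succ_mul_X, PowerSeries.coeff_succ_X_mul]
    simp only [map_add, PowerSeries.coeff_mk]
    rw [show 2 * (m + 1) = 2 * m + 1 + 1 by ring, Finset.sum_range_succ, Finset.sum_range_succ]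
    ring

/-- The generating function of the chains that end in an even value. -/
def evenSeries (a : ℕ → ℤ) (i : ℕ) : PowerSeries ℤ :=
  PowerSeries.mk fun m => (chainCount a i (2 * m) : ℤ)

/-- The generating function of the chains that end in an odd value. -/
def oddSeries (a : ℕ → ℤ) (i : ℕ) : PowerSeries ℤ :=
  PowerSeries.mk fun m => (chainCount a i (2 * m + 1) : ℤ)

/-- The generating function of the chains with values less than `2 * m`. -/
def chainSeries (a : ℕ → ℤ) (i : ℕ) : PowerSeries ℤ :=
  PowerSeries.mk fun m => ∑ c ∈ Finset.range (2 * m), (chainCount a i c : ℤ)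

open PowerSeries in
theorem chainSeries_mul (a : ℕ → ℤ) (i : ℕ) :
    chainSeries a i * (1 - X) = X * (evenSeries a i + oddSeries a i) :=
  mk_sum_range_two_mul fun c => (chainCount a i c : ℤ)

open PowerSeries in
theorem one_sub_X_mul_inv : (PowerSeries.mk fun _ => (1 : ℤ)) * (1 - X) = 1 :=
  PowerSeries.mk_one_mul_one_sub_eq_one ℤ

-- After an ascent only odd values may be repeated, so the chains ending in `2m + 2` and in `2m + 1`
-- are counted by the same sum, over previous values up to `2m + 1`. This ties the even series to
-- the odd one.
open PowerSeries in
theorem series_of_lt {a : ℕ → ℤ} {i : ℕ} (h : a i < a (i + 1)) :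
    evenSeries a (i + 1) = X * oddSeries a (i + 1) ∧
      oddSeries a (i + 1) * (1 - X) = evenSeries a i + oddSeries a i := by
  have h1 : evenSeries a (i + 1) = chainSeries a i := by
    ext m
    simp [evenSeries, chainSeries, chainCount, h.le]
  have h2 : evenSeries a (i + 1) = X * oddSeries a (i + 1) := by
    rw [h1]
    ext m
    cases m with
    | zero => simp [chainSeries]
    | succ m =>
      rw [PowerSeries.coeff_succ_X_mul]
      simp [oddSeries, chainSeries, chainCount, h, show 2 * (m + 1) = 2 * m + 1 + 1 by ring,
        Finset.sum_range_succ]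
  refine ⟨h2, mul_left_cancel₀ (PowerSeries.X_ne_zero) ?_⟩
  rw [← chainSeries_mul, ← h1, h2, mul_assoc]

-- After a descent only even values may be repeated, so endings in `2m` and `2m + 1` both count all
-- previous values up to `2m`.
open PowerSeries in
theorem series_of_gt {a : ℕ → ℤ} {i : ℕ} (h : a (i + 1) < a i) :
    evenSeries a (i + 1) = oddSeries a (i + 1) ∧
      oddSeries a (i + 1) * (1 - X) = evenSeries a i + X * oddSeries a i := by
  have h1 : evenSeries a (i + 1) = chainSeries a i + evenSeries a i := by
    ext m
    simp [evenSeries, chainSeries, chainCount, h]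
  have h2 : evenSeries a (i + 1) = oddSeries a (i + 1) := by
    ext m
    simp [evenSeries, oddSeries, chainCount, h, h.le, Finset.sum_range_succ]
  refine ⟨h2, ?_⟩
  rw [← h2, h1, add_mul, chainSeries_mul]
  ring

-- A two-state automaton: the state records whether the last step was an ascent (even series = `X`
-- times odd series) or not (the series agree). Up to the factor `1 - X`, entering the ascent state
-- multiplies the odd series by `2`, leaving it by `2 * X`, and staying in either state by `1 + X`.
-- Leaving it is exactly a peak, so each peak collects `4 * X`; a final open ascent leaves an extra
-- `2`.
open PowerSeries in
theorem series_eq (a : ℕ → ℤ) (i : ℕ) (ha : ∀ j < i, a j ≠ a (j + 1)) :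
    ∃ r, ((∀ j, i = j + 1 → a i < a j) ∧ i = 2 * peakCount a i + r ∧
        evenSeries a i = oddSeries a i ∧
        oddSeries a i * (1 - X) ^ (i + 1) = (4 * X) ^ peakCount a i * (1 + X) ^ r) ∨
      ((∃ j, i = j + 1 ∧ a j < a i) ∧ i = 2 * peakCount a i + 1 + r ∧
        evenSeries a i = X * oddSeries a i ∧
        oddSeries a i * (1 - X) ^ (i + 1) = 2 * (4 * X) ^ peakCount a i * (1 + X) ^ r) := by
  induction i with
  | zero =>
    refine ⟨0, Or.inl ⟨by simp, by simp [peakCount], rfl, ?_⟩⟩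
    simpa [oddSeries, chainCount, peakCount] using one_sub_X_mul_inv
  | succ i ih =>
    -- The new step creates a peak exactly when it is a descent taken from the ascent state; `b`
    -- records this.
    have hpk : ∀ b : Bool, (b = true ↔ (∃ j, i = j + 1 ∧ a j < a i) ∧ a (i + 1) < a i) →
        peakCount a (i + 1) = peakCount a i + b.toNat := by
      intro b hb
      cases i with
      | zero =>
        obtain rfl : b = false := by simpa using hb
        simp [peakCount]
      | succ i =>
        rw [peakCount_add_two]
        cases b <;> simp_all
    obtain ⟨r, ⟨h0, hi, he, ho⟩ | ⟨h0, hi, he, ho⟩⟩ := ih fun j hj => ha j (by omega)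
    · have hpk := hpk false (by
        simp only [Bool.false_eq_true, false_iff]
        rintro ⟨⟨j, hj, hlt⟩, -⟩
        exact absurd hlt (h0 j hj).le.not_gt)
      simp only [Bool.toNat_false, add_zero] at hpk
      rw [hpk]
      rcases lt_or_gt_of_ne (ha i (by omega)) with hlt | hlt
      · obtain ⟨h1, h2⟩ := series_of_lt hlt
        refine ⟨r, Or.inr ⟨⟨i, rfl, hlt⟩, by omega, h1, ?_⟩⟩
        rw [pow_succ', ← mul_assoc, h2, he, ← two_mul, mul_assoc, ho]
        ring
      · obtain ⟨h1, h2⟩ := series_of_gt hlt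
        refine ⟨r + 1, Or.inl ⟨fun j hj => ?_, by omega, h1, ?_⟩⟩
        · obtain rfl : i = j := by omega
          exact hlt
        · rw [pow_succ', ← mul_assoc, h2, he]
          linear_combination (1 + X) * ho
    · rcases lt_or_gt_of_ne (ha i (by omega)) with hlt | hlt
      · have hpk := hpk false (by simp [hlt.le])
        simp only [Bool.toNat_false, add_zero] at hpk
        rw [hpk]
        obtain ⟨h1, h2⟩ := series_of_lt hlt
        refine ⟨r + 1, Or.inr ⟨⟨i, rfl, hlt⟩, by omega, h1, ?_⟩⟩
        rw [pow_succ', ← mul_assoc, h2, he]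
        linear_combination (1 + X) * ho
      · have hpk := hpk true (by simp [hlt, h0])
        simp only [Bool.toNat_true] at hpk
        rw [hpk]
        obtain ⟨h1, h2⟩ := series_of_gt hlt
        refine ⟨r, Or.inl ⟨fun j hj => ?_, by omega, h1, ?_⟩⟩
        · obtain rfl : i = j := by omega
          exact hlt
        · rw [pow_succ', ← mul_assoc, h2, he]
          linear_combination 2 * X * ho

-- Summing over the last value evens out the two states: the open ascent's `2 * X * (1 + X)`
-- supplies the missing factor `1 + X`.
open PowerSeries in
theorem chainSeries_eq (a : ℕ → ℤ) (i : ℕ) (ha : ∀ j < i, a j ≠ a (j + 1)) :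
    2 * peakCount a i ≤ i ∧ chainSeries a i * (1 - X) ^ (i + 2) =
      2 * X * (4 * X) ^ peakCount a i * (1 + X) ^ (i - 2 * peakCount a i) := by
  obtain ⟨r, ⟨-, hi, he, ho⟩ | ⟨-, hi, he, ho⟩⟩ := series_eq a i ha
  · refine ⟨by omega, ?_⟩
    rw [show i - 2 * peakCount a i = r by omega, pow_succ', ← mul_assoc, chainSeries_mul, he]
    linear_combination 2 * X * ho
  · refine ⟨by omega, ?_⟩
    rw [show i - 2 * peakCount a i = r + 1 by omega, pow_succ', ← mul_assoc, chainSeries_mul, he]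
    linear_combination X * (1 + X) * ho

/-! ### Counting enriched chains by their last value -/

theorem Fin.strictMono_succ_iff {α : Type*} [Preorder α] {i : ℕ} (f : Fin (i + 2) → α) :
    StrictMono f ↔ StrictMono (fun j : Fin (i + 1) => f j.castSucc) ∧
      f (Fin.last i).castSucc < f (Fin.last (i + 1)) := by
  rw [Fin.strictMono_iff_lt_succ, Fin.forall_fin_succ', Fin.strictMono_iff_lt_succ]
  simp only [Fin.succ_last, Fin.succ_castSucc]

/-- The enriched chains of values less than `M` on the word `a 0, …, a i`. -/
noncomputable def enrichedChains (a : ℕ → ℤ) (i M : ℕ) : Finset (Fin (i + 1) → Fin M) :=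
  {g | StrictMono fun j => enrichedKey (g j) (a j)}

theorem mem_enrichedChains {a : ℕ → ℤ} {i M : ℕ} {g : Fin (i + 1) → Fin M} :
    g ∈ enrichedChains a i M ↔ StrictMono fun j => enrichedKey (g j) (a j) := by
  simp [enrichedChains]

/-- Deleting the last letter leaves a chain whose last key lies below the deleted one: its value is
smaller than `c`, or equal to `c` when the parity of `c` matches the ascent or descent. This is the
recursion of `chainCount`. -/
theorem card_enrichedChains_last (a : ℕ → ℤ) (i M : ℕ) (c : Fin M) :
    ((enrichedChains a i M).filter fun g => g (Fin.last i) = c).card = chainCount a i c := by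
  induction i generalizing c with
  | zero =>
    have : Subsingleton (Fin (0 + 1)) := inferInstanceAs (Subsingleton (Fin 1))
    refine Finset.card_eq_one.mpr ?_
    refine ⟨fun _ => c, ?_⟩
    ext g
    simp only [Finset.mem_filter, mem_enrichedChains, Finset.mem_singleton]
    constructor
    · rintro ⟨-, h⟩
      funext j
      rw [Subsingleton.elim j (Fin.last 0), h]
    · rintro rfl
      exact ⟨Subsingleton.strictMono _, rfl⟩
  | succ i ih =>
    have h1 : ((enrichedChains a (i + 1) M).filter fun g => g (Fin.last (i + 1)) = c).card =
        ((enrichedChains a i M).filter fun g =>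
          enrichedKey (g (Fin.last i)) (a i) < enrichedKey c (a (i + 1))).card := by
      refine Finset.card_nbij' (fun g j => g j.castSucc)
        (fun g => Fin.snoc (α := fun _ => Fin M) g c) ?_ ?_ ?_ ?_
      · intro g hg
        simp only [Finset.coe_filter, Set.mem_ofPred_eq, mem_enrichedChains,
          Fin.strictMono_succ_iff] at hg ⊢
        obtain ⟨⟨hg1, hg2⟩, rfl⟩ := hg
        exact ⟨hg1, by simpa using hg2⟩
      · intro g hg
        simp only [Finset.coe_filter, Set.mem_ofPred_eq, mem_enrichedChains,
          Fin.strictMono_succ_iff] at hg ⊢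
        simpa using hg
      · intro g hg
        simp only [Finset.coe_filter, Set.mem_ofPred_eq] at hg
        obtain ⟨-, rfl⟩ := hg
        exact Fin.snoc_init_self g
      · intro g hg
        funext j
        simp
    rw [h1, Finset.card_eq_sum_card_fiberwise (f := fun g => g (Fin.last i)) (t := Finset.univ)
      (fun _ _ => Finset.mem_coe.mpr (Finset.mem_univ _))]
    have h2 : ∀ b : Fin M, (((enrichedChains a i M).filter fun g =>
          enrichedKey (g (Fin.last i)) (a i) < enrichedKey c (a (i + 1))).filter
            fun g => g (Fin.last i) = b).card =
        if enrichedKey b (a i) < enrichedKey c (a (i + 1)) then chainCount a i b else 0 := by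
      intro b
      rw [Finset.filter_filter]
      split_ifs with hb
      · rw [← ih b]
        congr 1
        refine Finset.filter_congr fun g _ => and_iff_right_of_imp ?_
        rintro rfl
        exact hb
      · rw [Finset.card_eq_zero, Finset.filter_eq_empty_iff]
        rintro g - ⟨h, rfl⟩
        exact hb h
    rw [Finset.sum_congr rfl fun b _ => h2 b, Fin.sum_univ_eq_sum_range (fun b =>
      if enrichedKey b (a i) < enrichedKey c (a (i + 1)) then chainCount a i b else 0) M]
    obtain ⟨c, hc⟩ := c
    simp only [chainCount]
    rw [← Finset.sum_range_add_sum_Ico _ hc, Finset.sum_range_succ, Finset.sum_eq_zero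
      (s := Finset.Ico (c + 1) M), add_zero]
    · congr 1
      · refine Finset.sum_congr rfl fun b hb => if_pos ?_
        rw [enrichedKey_lt_iff]
        exact Or.inl (Finset.mem_range.mp hb)
      · refine if_congr ?_ rfl rfl
        simp [enrichedKey_lt_iff]
    · intro b hb
      rw [Finset.mem_Ico] at hb
      refine if_neg ?_
      rw [enrichedKey_lt_iff]
      omega

theorem card_enrichedChains (a : ℕ → ℤ) (i M : ℕ) :
    (enrichedChains a i M).card = ∑ c ∈ Finset.range M, chainCount a i c := by
  rw [Finset.card_eq_sum_card_fiberwise (f := fun g => g (Fin.last i)) (t := Finset.univ)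
      (fun _ _ => Finset.mem_coe.mpr (Finset.mem_univ _)), ← Fin.sum_univ_eq_sum_range]
  exact Finset.sum_congr rfl fun c _ => card_enrichedChains_last a i M c

/-! ### Enriched partitions and linear extensions -/

/-- The linear extensions of `P`, as enumerations by `Fin p`. -/
def linearExtensions (P : Type*) [PartialOrder P] (p : ℕ) : Set (Fin p ≃ P) :=
  {e | ∀ i j, e i ≤ e j → i ≤ j}

/-- `f` is an enriched partition of the labeled poset `(P, ω)`. -/
def IsEnrichedPartition {P : Type*} [PartialOrder P] (ω : P → ℤ) (f : P → ℕ) : Prop :=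
  ∀ x y, x < y → enrichedKey (f x) (ω x) < enrichedKey (f y) (ω y)

theorem existsUnique_sorting {P κ : Type*} [Fintype P] [LinearOrder κ] {p : ℕ}
    (hp : Fintype.card P = p) (k : P → κ) (hk : Function.Injective k) :
    ∃! e : Fin p ≃ P, StrictMono fun i => k (e i) := by
  let _ : LinearOrder P := LinearOrder.lift' k hk
  have hlt : ∀ x y : P, x < y ↔ k x < k y := fun x y => Iff.rfl
  refine ⟨(monoEquivOfFin P hp).toEquiv, fun i j hij => ?_, fun e he => ?_⟩
  · exact (hlt _ _).mp ((monoEquivOfFin P hp).strictMono hij)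
  · have he' : StrictMono e := fun i j hij => (hlt _ _).mpr (he hij)
    have : he'.orderIsoOfSurjective e e.surjective = monoEquivOfFin P hp :=
      Subsingleton.elim _ _
    rw [← this]
    ext i
    rfl

-- Since `ω` is injective, the keys of any `f` are distinct and sort `P` in a unique way; `f` is an
-- enriched partition exactly when this sorting is a linear extension. The fibre over an extension
-- `e` consists of the enriched chains on the word `ω ∘ e`.
open Classical in
theorem card_enrichedPartition {P : Type*} [Fintype P] [PartialOrder P] {p : ℕ}
    (hp : Fintype.card P = p) {ω : P → ℤ} (hω : Function.Injective ω) (M : ℕ) :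
    (Finset.univ.filter fun f : P → Fin M => IsEnrichedPartition ω fun x => (f x : ℕ)).card =
      ∑ e ∈ (Finset.univ.filter fun e : Fin p ≃ P => e ∈ linearExtensions P p),
        (Finset.univ.filter fun g : Fin p → Fin M =>
          StrictMono fun j => enrichedKey (g j) (ω (e j))).card := by
  choose s hs hs' using fun f : P → Fin M => existsUnique_sorting hp
    (fun x => enrichedKey (f x) (ω x)) (enrichedKey_injective hω _)
  have hmem : ∀ f, s f ∈ linearExtensions P p ↔ IsEnrichedPartition ω fun x => (f x : ℕ) := by
    intro f
    constructor
    · intro h x y hxy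
      obtain ⟨i, rfl⟩ := (s f).surjective x
      obtain ⟨j, rfl⟩ := (s f).surjective y
      refine hs f (lt_of_le_of_ne (h i j hxy.le) ?_)
      rintro rfl
      exact lt_irrefl _ hxy
    · intro h i j hij
      rcases hij.eq_or_lt with heq | hlt
      · exact ((s f).injective heq).le
      · exact ((hs f).lt_iff_lt.mp (h _ _ hlt)).le
  rw [Finset.card_eq_sum_card_fiberwise (f := s)
    (t := Finset.univ.filter fun e : Fin p ≃ P => e ∈ linearExtensions P p)]
  · refine Finset.sum_congr rfl fun e he => ?_
    rw [Finset.mem_filter] at he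
    refine Finset.card_nbij' (fun f => f ∘ e) (fun g => g ∘ e.symm) ?_ ?_ ?_ ?_
    · intro f hf
      simp only [Finset.coe_filter, Finset.mem_filter, Finset.mem_univ, true_and,
        Set.mem_ofPred_eq] at hf ⊢
      obtain ⟨-, rfl⟩ := hf
      exact hs f
    · intro g hg
      simp only [Finset.coe_filter, Finset.mem_filter, Finset.mem_univ, true_and,
        Set.mem_ofPred_eq] at hg ⊢
      have : e = s (g ∘ e.symm) := hs' _ e (by simpa using hg)
      exact ⟨(hmem _).mp (this ▸ he.2), this.symm⟩
    · intro f _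
      funext x
      simp
    · intro g _
      funext x
      simp
  · intro f hf
    simp only [Finset.coe_filter, Finset.mem_univ, true_and, Set.mem_ofPred_eq] at hf ⊢
    exact (hmem f).mpr hf

/-- The extension by zero of a word to a sequence. -/
def extendWord {q : ℕ} (a : Fin (q + 1) → ℤ) (j : ℕ) : ℤ :=
  if h : j < q + 1 then a ⟨j, h⟩ else 0

theorem extendWord_of_lt {q : ℕ} (a : Fin (q + 1) → ℤ) {j : ℕ} (h : j < q + 1) :
    extendWord a j = a ⟨j, h⟩ := dif_pos h

theorem extendWord_val {q : ℕ} (a : Fin (q + 1) → ℤ) (j : Fin (q + 1)) :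
    extendWord a j = a j := extendWord_of_lt a j.2

theorem peak_eq_peakCount {q : ℕ} (a : Fin (q + 1) → ℤ) :
    peak a = peakCount (extendWord a) q := by
  unfold peak peakCount
  rw [← Set.ncard_coe_finset]
  refine Set.ncard_congr (fun j _ => (j : ℕ) - 1) ?_ ?_ ?_
  · rintro j ⟨i, k, hi, hk, h1, h2⟩
    simp only [Finset.coe_filter, Finset.mem_range, Set.mem_ofPred_eq]
    obtain ⟨i, hi'⟩ := i
    obtain ⟨j, hj'⟩ := j
    obtain ⟨k, hk'⟩ := k
    dsimp only at hi hk
    subst hi hk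
    rw [Nat.add_sub_cancel, extendWord_of_lt a hi', extendWord_of_lt a hj',
      extendWord_of_lt a hk']
    exact ⟨by omega, h1, h2⟩
  · rintro i j ⟨i', k, hi, -⟩ ⟨j', k', hj, -⟩ h
    ext
    omega
  · intro b hb
    simp only [Finset.coe_filter, Finset.mem_range, Set.mem_ofPred_eq] at hb
    obtain ⟨hb, h1, h2⟩ := hb
    rw [extendWord_of_lt a (show b < q + 1 by omega),
      extendWord_of_lt a (show b + 1 < q + 1 by omega)] at h1
    rw [extendWord_of_lt a (show b + 2 < q + 1 by omega),
      extendWord_of_lt a (show b + 1 < q + 1 by omega)] at h2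
    exact ⟨⟨b + 1, by omega⟩, ⟨⟨b, by omega⟩, ⟨b + 2, by omega⟩, rfl, rfl, h1, h2⟩, rfl⟩

open Classical in
theorem ncard_jordanHolder_peak {P : Type*} [Fintype P] [PartialOrder P] {p : ℕ}
    (hp : Fintype.card P = p) {ω : P → ℤ} (hω : Function.Injective ω) (j : ℕ) :
    Set.ncard {a ∈ jordanHolder ω | peak a = j} =
      ((Finset.univ.filter fun e : Fin p ≃ P => e ∈ linearExtensions P p).filter
        fun e : Fin p ≃ P => peak (ω ∘ e) = j).card := by
  subst hp
  rw [← Set.ncard_coe_finset]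
  symm
  refine Set.ncard_congr (fun e _ => ω ∘ e) ?_ ?_ ?_
  · intro e he
    simp only [Finset.filter_filter, Finset.coe_filter, Finset.mem_univ, true_and,
      Set.mem_ofPred_eq] at he
    exact ⟨⟨e, he.1, fun _ => rfl⟩, he.2⟩
  · intro e e' _ _ h
    ext i
    exact hω (congrFun h i)
  · rintro a ⟨⟨e, he, ha⟩, hj⟩
    obtain rfl : a = ω ∘ e := funext ha
    exact ⟨e, by simpa [Finset.filter_filter] using ⟨he, hj⟩, rfl⟩

/-- The number of enriched partitions of `(P, ω)` with values less than `M`. -/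
noncomputable def enrichedCount {P : Type*} [Fintype P] [PartialOrder P] (ω : P → ℤ) (M : ℕ) : ℕ :=
  Nat.card {f : P → Fin M // IsEnrichedPartition ω fun x => (f x : ℕ)}

open PowerSeries in
open Classical in
theorem enrichedCount_series {P : Type*} [Fintype P] [PartialOrder P] {q : ℕ}
    (hp : Fintype.card P = q + 1) {ω : P → ℤ} (hω : Function.Injective ω) :
    (PowerSeries.mk fun m => (enrichedCount ω (2 * m) : ℤ)) * (1 - X) ^ (q + 2) =
      ∑ j ∈ Finset.range (q / 2 + 1), (Set.ncard {a ∈ jordanHolder ω | peak a = j} : ℤ⟦X⟧) *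
        (2 * X * (4 * X) ^ j * (1 + X) ^ (q - 2 * j)) := by
  set E := Finset.univ.filter fun e : Fin (q + 1) ≃ P => e ∈ linearExtensions P (q + 1) with hE
  have hne : ∀ e : Fin (q + 1) ≃ P, ∀ j < q,
      extendWord (ω ∘ e) j ≠ extendWord (ω ∘ e) (j + 1) := by
    intro e j hj h
    rw [extendWord_of_lt _ (show j < q + 1 by omega),
      extendWord_of_lt _ (show j + 1 < q + 1 by omega)] at h
    have := (hω.comp e.injective) h
    rw [Fin.mk.injEq] at this
    omega
  have h1 : (PowerSeries.mk fun m => (enrichedCount ω (2 * m) : ℤ)) =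
      ∑ e ∈ E, chainSeries (extendWord (ω ∘ e)) q := by
    ext m
    rw [map_sum, PowerSeries.coeff_mk, enrichedCount, Nat.card_eq_fintype_card,
      Fintype.card_subtype, card_enrichedPartition hp hω]
    push_cast
    refine Finset.sum_congr rfl fun e _ => ?_
    rw [chainSeries, PowerSeries.coeff_mk, ← Nat.cast_sum, ← card_enrichedChains, enrichedChains]
    simp only [extendWord_val, Function.comp_apply]
  rw [h1, Finset.sum_mul, ← Finset.sum_fiberwise_of_maps_to (s := E)
    (t := Finset.range (q / 2 + 1)) (g := fun e => peak (ω ∘ e))]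
  · refine Finset.sum_congr rfl fun j _ => ?_
    rw [ncard_jordanHolder_peak hp hω, ← nsmul_eq_mul, ← Finset.sum_const]
    refine Finset.sum_congr rfl fun e he => ?_
    rw [Finset.mem_filter, peak_eq_peakCount] at he
    rw [(chainSeries_eq _ _ (hne e)).2, he.2]
  · intro e _
    have := (chainSeries_eq _ _ (hne e)).1
    rw [Finset.mem_range, peak_eq_peakCount]
    omega

/-! ### Crown posets -/

namespace Crown

variable {n : ℕ}

theorem pos_lt (x : Crown n) : x.pos < 2 * n := Fin.isLt (n := 2 * n) x

theorem pos_injective : Function.Injective (pos : Crown n → ℕ) := Fin.val_injective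

/-- The element of the crown poset at a given position. -/
def ofPos (i : ℕ) (h : i < 2 * n) : Crown n := (⟨i, h⟩ : Fin (2 * n))

@[simp] theorem pos_ofPos (i : ℕ) (h : i < 2 * n) : (ofPos i h).pos = i := rfl

theorem le_iff {x y : Crown n} : x ≤ y ↔ x = y ∨ Rel x y := Iff.rfl

theorem lt_iff {x y : Crown n} : x < y ↔ Rel x y := by
  rw [lt_iff_le_and_ne, le_iff]
  constructor
  · rintro ⟨h | h, hne⟩
    · exact absurd h hne
    · exact h
  · intro h
    refine ⟨Or.inr h, ?_⟩
    rintro rfl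
    exact absurd h.2.1 (Nat.not_odd_iff_even.mpr h.1)

theorem exists_rel_of_even {x : Crown n} (hx : Even x.pos) : ∃ y, Rel x y := by
  have := x.pos_lt
  obtain ⟨k, hk⟩ := hx
  refine ⟨ofPos (x.pos + 1) (by omega), ⟨k, hk⟩, ?_, Or.inl rfl⟩
  rw [pos_ofPos]
  exact Even.add_one ⟨k, hk⟩

theorem exists_rel_of_odd {y : Crown n} (hy : Odd y.pos) : ∃ x, Rel x y := by
  have := y.pos_lt
  obtain ⟨k, hk⟩ := hy
  refine ⟨ofPos (2 * k) (by omega), ?_, ⟨k, hk⟩, Or.inl hk⟩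
  rw [pos_ofPos]
  exact even_two_mul k

theorem card_withTop (n : ℕ) : Fintype.card (WithTop (Crown n)) = 2 * n + 1 := by
  rw [show Fintype.card (WithTop (Crown n)) = Fintype.card (Option (Crown n)) from
    Fintype.card_congr (Equiv.refl _), Fintype.card_option]
  exact congrArg (· + 1) (Fintype.card_fin (2 * n))

end Crown

/-! ### Canonical labelings of the crown with a greatest element -/

/-- The signs of the cover relations of the crown poset with a greatest element adjoined
alternate along the maximal chains. -/
structure HasCanonicalSigns {n : ℕ} (ω : WithTop (Crown n) → ℤ) : Prop where
  lt_of_rel : ∀ x y : Crown n, Crown.Rel x y → ω x < ω y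
  top_lt_of_odd : ∀ y : Crown n, Odd y.pos → ω ⊤ < ω y

theorem Crown.covBy_of_rel {n : ℕ} {x y : Crown n} (h : Crown.Rel x y) :
    (x : WithTop (Crown n)) ⋖ y := by
  refine ⟨WithTop.coe_lt_coe.mpr (Crown.lt_iff.mpr h), fun z h1 h2 => ?_⟩
  induction z using WithTop.recTopCoe with
  | top => exact absurd h2 (by simp)
  | coe z =>
    rw [WithTop.coe_lt_coe, Crown.lt_iff] at h1 h2
    exact Nat.not_odd_iff_even.mpr h2.1 h1.2.1

theorem Crown.covBy_top_of_odd {n : ℕ} {y : Crown n} (h : Odd y.pos) :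
    (y : WithTop (Crown n)) ⋖ ⊤ := by
  refine ⟨WithTop.coe_lt_top y, fun z h1 h2 => ?_⟩
  induction z using WithTop.recTopCoe with
  | top => exact absurd h2 (by simp)
  | coe z =>
    rw [WithTop.coe_lt_coe, Crown.lt_iff] at h1
    exact Nat.not_odd_iff_even.mpr h1.1 h

theorem Crown.isMin_coe_of_even {n : ℕ} {x : Crown n} (h : Even x.pos) :
    IsMin (x : WithTop (Crown n)) := by
  intro z hz
  induction z using WithTop.recTopCoe with
  | top => simp at hz
  | coe z =>
    rw [WithTop.coe_le_coe, Crown.le_iff] at hz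
    rcases hz with rfl | hz
    · exact le_rfl
    · exact absurd hz.2.1 (Nat.not_odd_iff_even.mpr h)

/-- Ranks change by one along covers and stay in `{0, 1}`: from a minimal element the rank must rise
to `1`, and on to the top it must fall back to `0`. -/
theorem IsCanonicalLabeling.hasCanonicalSigns {n : ℕ} {ω : WithTop (Crown n) → ℤ}
    (h : IsCanonicalLabeling ω) : HasCanonicalSigns ω := by
  obtain ⟨hinj, ρ, ⟨hmin, hcov, -⟩, h01, -⟩ := h
  have key : ∀ x y : Crown n, Crown.Rel x y → ω x < ω y ∧ ρ y = 1 := by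
    intro x y hxy
    have h1 := hcov x y (Crown.covBy_of_rel hxy)
    rw [hmin x (Crown.isMin_coe_of_even hxy.1), labelSign] at h1
    have h2 := h01 y
    split_ifs at h1 with h3
    · exact ⟨h3, by omega⟩
    · omega
  refine ⟨fun x y hxy => (key x y hxy).1, fun y hy => ?_⟩
  obtain ⟨x, hxy⟩ := Crown.exists_rel_of_odd hy
  have h1 := hcov y ⊤ (Crown.covBy_top_of_odd hy)
  rw [(key x y hxy).2, labelSign] at h1
  have h2 := h01 ⊤
  have h3 : ω y ≠ ω ⊤ := hinj.ne (WithTop.coe_ne_top)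
  split_ifs at h1 <;> omega

/-- A canonical labeling of the crown poset with a greatest element adjoined. -/
def crownLabeling (n : ℕ) : WithTop (Crown n) → ℤ :=
  WithTop.recTopCoe (C := fun _ => ℤ) (-1) fun x =>
    if Even x.pos then x.pos else 2 * n + x.pos

/-- The rank is `1` at the odd positions and `0` elsewhere; the shift by `2 * n` puts all labels of
rank one above those of rank zero. -/
theorem isCanonicalLabeling_crownLabeling {n : ℕ} (hn : 1 ≤ n) :
    IsCanonicalLabeling (crownLabeling n) := by
  have htop : crownLabeling n ⊤ = -1 := rfl
  have hcoe : ∀ x : Crown n, crownLabeling n x =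
    if Even x.pos then (x.pos : ℤ) else 2 * n + x.pos := fun _ => rfl
  refine ⟨?_, WithTop.recTopCoe (C := fun _ => ℤ) 0 fun x => if Even x.pos then 0 else 1,
    ⟨?_, ?_, ?_⟩, ?_, ?_⟩
  · intro x y h
    induction x using WithTop.recTopCoe with
    | top =>
      induction y using WithTop.recTopCoe with
      | top => rfl
      | coe y => rw [htop, hcoe] at h; split_ifs at h; all_goals omega
    | coe x =>
      induction y using WithTop.recTopCoe with
      | top => rw [htop, hcoe] at h; split_ifs at h; all_goals omega
      | coe y =>
        have h1 := x.pos_lt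
        have h2 := y.pos_lt
        rw [hcoe, hcoe] at h
        rw [Crown.pos_injective (show x.pos = y.pos by split_ifs at h <;> omega)]
  · intro x hx
    induction x using WithTop.recTopCoe with
    | top => rfl
    | coe x =>
      by_contra hne
      have hodd : Odd x.pos := by
        by_contra h
        exact hne (if_pos (Nat.not_odd_iff_even.mp h))
      obtain ⟨y, hy⟩ := Crown.exists_rel_of_odd hodd
      have hlt : (y : WithTop (Crown n)) < x := WithTop.coe_lt_coe.mpr (Crown.lt_iff.mpr hy)
      exact not_le_of_gt hlt (hx (le_of_lt hlt))
  · intro x y hxy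
    induction x using WithTop.recTopCoe with
    | top => exact absurd hxy.1 not_top_lt
    | coe x =>
      induction y using WithTop.recTopCoe with
      | top =>
        have hodd : ¬ Even x.pos := fun h => by
          obtain ⟨y, hy⟩ := Crown.exists_rel_of_even h
          exact hxy.2 (WithTop.coe_lt_coe.mpr (Crown.lt_iff.mpr hy)) (WithTop.coe_lt_top y)
        rw [labelSign, htop, hcoe]
        change 0 = (if Even x.pos then (0 : ℤ) else 1) + _
        rw [if_neg hodd, if_neg hodd, if_neg (by omega)]
        rfl
      | coe y =>
        have h := Crown.lt_iff.mp (WithTop.coe_lt_coe.mp hxy.1)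
        have hx := h.1
        have hy := Nat.not_even_iff_odd.mpr h.2.1
        have := x.pos_lt
        rw [labelSign, hcoe, hcoe]
        change (if Even y.pos then (0 : ℤ) else 1) = (if Even x.pos then (0 : ℤ) else 1) + _
        rw [if_neg hy, if_pos hx, if_pos hx, if_neg hy, if_pos (by omega)]
        rfl
  · intro x y hx hy
    rw [isMax_iff_eq_top] at hx hy
    rw [hx, hy]
  · intro x
    induction x using WithTop.recTopCoe with
    | top => exact Or.inl rfl
    | coe x =>
      by_cases h : Even x.pos
      · exact Or.inl (if_pos h)
      · exact Or.inr (if_neg h)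
  · intro x y
    induction x using WithTop.recTopCoe with
    | top =>
      induction y using WithTop.recTopCoe with
      | top => exact fun h => absurd h (lt_irrefl _)
      | coe y =>
        intro _
        rw [htop, hcoe]
        split_ifs <;> omega
    | coe x =>
      induction y using WithTop.recTopCoe with
      | top =>
        intro h
        change (if Even x.pos then (0 : ℤ) else 1) < 0 at h
        split_ifs at h <;> omega
      | coe y =>
        intro h
        change (if Even x.pos then (0 : ℤ) else 1) < (if Even y.pos then (0 : ℤ) else 1) at h
        have := x.pos_lt
        rw [hcoe, hcoe]
        split_ifs at h ⊢ <;> omega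

theorem isEnrichedPartition_iff {n : ℕ} {ω : WithTop (Crown n) → ℤ} (hω : HasCanonicalSigns ω)
    (f : WithTop (Crown n) → ℕ) :
    IsEnrichedPartition ω f ↔
      (∀ x y : Crown n, Crown.Rel x y → f x < f y ∨ (f x = f y ∧ ¬ Even (f x))) ∧
        ∀ y : Crown n, Odd y.pos → f y < f ⊤ ∨ (f y = f ⊤ ∧ Even (f y)) := by
  constructor
  · intro h
    refine ⟨fun x y hxy => ?_, fun y hy => ?_⟩
    · have h1 := h x y (Crown.covBy_of_rel hxy).1
      have h2 := hω.lt_of_rel x y hxy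
      rw [enrichedKey_lt_iff] at h1
      exact h1.imp id fun h3 => ⟨h3.1, by
        rcases h3.2 with h4 | h4
        · exact absurd h4.2 h2.le.not_gt
        · exact h4.1⟩
    · have h1 := h y ⊤ (WithTop.coe_lt_top y)
      have h2 := hω.top_lt_of_odd y hy
      rw [enrichedKey_lt_iff] at h1
      exact h1.imp id fun h3 => ⟨h3.1, by
        rcases h3.2 with h4 | h4
        · exact h4.1
        · exact absurd h4.2 h2.le.not_gt⟩
  · rintro ⟨h1, h2⟩
    intro x y hxy
    rw [enrichedKey_lt_iff]
    induction x using WithTop.recTopCoe with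
    | top => exact absurd hxy not_top_lt
    | coe x =>
      induction y using WithTop.recTopCoe with
      | top =>
        by_cases hx : Even x.pos
        · obtain ⟨y, hy⟩ := Crown.exists_rel_of_even hx
          have h3 := h1 x y hy
          have h4 := h2 y hy.2.1
          -- Through an intermediate `y` the inequality is strict: equality in both steps would make
          -- the common value both odd and even.
          refine Or.inl ?_
          rcases h3 with h3 | ⟨h3, h3'⟩ <;> rcases h4 with h4 | ⟨h4, h4'⟩
          · omega
          · omega
          · omega
          · exact absurd (h3 ▸ h4') h3'
        · have hx := Nat.not_even_iff_odd.mp hx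
          exact (h2 x hx).imp id fun h => ⟨h.1, Or.inl ⟨h.2, hω.top_lt_of_odd x hx⟩⟩
      | coe y =>
        have h := Crown.lt_iff.mp (WithTop.coe_lt_coe.mp hxy)
        exact (h1 x y h).imp id fun h' => ⟨h'.1, Or.inr ⟨h'.2, hω.lt_of_rel x y h⟩⟩

/-! ### Enriched partitions of the crown poset -/

/-- The number of order preserving maps from `P` to a chain with `k + 1` elements. -/
noncomputable def monotoneCount (P : Type*) [PartialOrder P] (k : ℕ) : ℕ :=
  Nat.card {g : P → Fin (k + 1) // Monotone g}

/-- The enriched partition that belongs to a choice of signs `ε` and an order preserving map `g`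
with values at most `k`. -/
def crownPartition {n : ℕ} (ε : WithTop (Crown n) → Bool) (k : ℕ) (g : Crown n → ℕ) :
    WithTop (Crown n) → ℕ := fun z =>
  WithTop.recTopCoe (C := fun _ => ℕ) (2 * (k + 1))
    (fun x => 2 * g x + if Even x.pos then 0 else 1) z + (ε z).toNat

theorem crownPartition_top {n : ℕ} (ε : WithTop (Crown n) → Bool) (k : ℕ) (g : Crown n → ℕ) :
    crownPartition ε k g ⊤ = 2 * (k + 1) + (ε ⊤).toNat := rfl

theorem crownPartition_even {n : ℕ} (ε : WithTop (Crown n) → Bool) (k : ℕ) (g : Crown n → ℕ)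
    {x : Crown n} (hx : Even x.pos) :
    crownPartition ε k g x = 2 * g x + (ε x).toNat := by
  change 2 * g x + (if Even x.pos then 0 else 1) + _ = _
  rw [if_pos hx, add_zero]

theorem crownPartition_odd {n : ℕ} (ε : WithTop (Crown n) → Bool) (k : ℕ) (g : Crown n → ℕ)
    {x : Crown n} (hx : Odd x.pos) :
    crownPartition ε k g x = 2 * g x + 1 + (ε x).toNat := by
  change 2 * g x + (if Even x.pos then 0 else 1) + _ = _
  rw [if_neg (Nat.not_even_iff_odd.mpr hx)]

/-- If `g x ≤ g y`, then `f x ≤ 2 * g y + 1 ≤ f y`, with equality only at an odd value; likewise `2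
* (k + 1)` separates `f y` from `f ⊤`, with equality only at an even value. The bits in `ε` are
therefore unconstrained. -/
theorem isEnrichedPartition_crownPartition {n : ℕ} {ω : WithTop (Crown n) → ℤ}
    (hω : HasCanonicalSigns ω) (ε : WithTop (Crown n) → Bool) {k : ℕ} {g : Crown n → ℕ}
    (hg : Monotone g) (hgk : ∀ x, g x ≤ k) :
    IsEnrichedPartition ω (crownPartition ε k g) := by
  rw [isEnrichedPartition_iff hω]
  constructor
  · intro x y h
    rw [crownPartition_even ε k g h.1, crownPartition_odd ε k g h.2.1, Nat.even_iff]
    have := hg (Crown.lt_iff.mpr h).le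
    have := (ε x).toNat_lt
    omega
  · intro y h
    rw [crownPartition_top, crownPartition_odd ε k g h, Nat.even_iff]
    have := hgk y
    have := (ε y).toNat_lt
    omega

theorem crownPartition_injective {n : ℕ} {ε ε' : WithTop (Crown n) → Bool} {k k' : ℕ}
    {g g' : Crown n → ℕ} (h : crownPartition ε k g = crownPartition ε' k' g') :
    ε = ε' ∧ k = k' ∧ g = g' := by
  have hb : ∀ b b' : Bool, b.toNat = b'.toNat → b = b' := by decide
  have htop := congrFun h ⊤
  rw [crownPartition_top, crownPartition_top] at htop
  have h1 := (ε ⊤).toNat_lt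
  have h2 := (ε' ⊤).toNat_lt
  have hx : ∀ x : Crown n, g x = g' x ∧ ε x = ε' x := by
    intro x
    have hx := congrFun h x
    have h1 := (ε x).toNat_lt
    have h2 := (ε' x).toNat_lt
    rcases Nat.even_or_odd x.pos with hp | hp
    · rw [crownPartition_even _ _ _ hp, crownPartition_even _ _ _ hp] at hx
      exact ⟨by omega, hb _ _ (by omega)⟩
    · rw [crownPartition_odd _ _ _ hp, crownPartition_odd _ _ _ hp] at hx
      exact ⟨by omega, hb _ _ (by omega)⟩
  refine ⟨?_, by omega, funext fun x => (hx x).1⟩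
  funext z
  induction z using WithTop.recTopCoe with
  | top => exact hb _ _ (by omega)
  | coe x => exact (hx x).2

/-- Values are halved at the even positions and the top, and halved after subtracting one at the odd
positions; the remainders are the bits. The parity conditions become weak inequalities of the
quotients. -/
theorem exists_crownPartition_eq {n : ℕ} (hn : 1 ≤ n) {ω : WithTop (Crown n) → ℤ}
    (hω : HasCanonicalSigns ω) {f : WithTop (Crown n) → ℕ} (hf : IsEnrichedPartition ω f) :
    ∃ (ε : WithTop (Crown n) → Bool) (g : Crown n → ℕ), Monotone g ∧ 2 ≤ f ⊤ ∧
      (∀ x, g x ≤ f ⊤ / 2 - 1) ∧ crownPartition ε (f ⊤ / 2 - 1) g = f := by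
  rw [isEnrichedPartition_iff hω] at hf
  obtain ⟨h1, h2⟩ := hf
  simp only [Nat.even_iff] at h1 h2
  have hodd : ∀ y : Crown n, Odd y.pos → 1 ≤ f y := fun y hy => by
    obtain ⟨x, hx⟩ := Crown.exists_rel_of_odd hy
    have := h1 x y hx
    omega
  -- Needed so that `f ⊤ / 2 - 1` is not truncated: some maximal crown element has value at least
  -- `1`, and a value `1` cannot be repeated at the top.
  have htop : 2 ≤ f ⊤ := by
    obtain ⟨y, hy⟩ := Crown.exists_rel_of_even (n := n) (x := Crown.ofPos 0 (by omega)) Even.zero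
    have h3 := hodd y hy.2.1
    have h4 := h2 y hy.2.1
    omega
  have hg0 : ∀ x : Crown n, Even x.pos →
      (f x - if Even x.pos then 0 else 1) / 2 = f x / 2 := fun x hx => by
    rw [if_pos hx, Nat.sub_zero]
  have hg1 : ∀ x : Crown n, Odd x.pos →
      (f x - if Even x.pos then 0 else 1) / 2 = (f x - 1) / 2 := fun x hx => by
    rw [if_neg (Nat.not_even_iff_odd.mpr hx)]
  have hrel : ∀ x y : Crown n, Crown.Rel x y → f x / 2 ≤ (f y - 1) / 2 := fun x y h => by
    have := h1 x y h
    omega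
  have hle : ∀ y : Crown n, Odd y.pos → (f y - 1) / 2 ≤ f ⊤ / 2 - 1 := fun y hy => by
    have := h2 y hy
    have := hodd y hy
    omega
  refine ⟨fun z => WithTop.recTopCoe (C := fun _ => Bool) (decide (f ⊤ % 2 = 1))
    (fun x : Crown n => decide ((f x - if Even x.pos then 0 else 1) % 2 = 1)) z,
    fun x => (f x - if Even x.pos then 0 else 1) / 2, ?_, htop, ?_, ?_⟩
  · intro x y h
    rcases Crown.le_iff.mp h with rfl | h
    · exact le_rfl
    · dsimp only
      rw [hg0 x h.1, hg1 y h.2.1]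
      exact hrel x y h
  · intro x
    dsimp only
    rcases Nat.even_or_odd x.pos with hx | hx
    · obtain ⟨y, hy⟩ := Crown.exists_rel_of_even hx
      rw [hg0 x hx]
      exact (hrel x y hy).trans (hle y hy.2.1)
    · rw [hg1 x hx]
      exact hle x hx
  · have hdec : ∀ m : ℕ, (decide (m % 2 = 1)).toNat = m % 2 := fun m => by
      rcases Nat.mod_two_eq_zero_or_one m with h | h <;> simp [h]
    funext z
    induction z using WithTop.recTopCoe with
    | top =>
      rw [crownPartition_top, WithTop.recTopCoe_top, hdec]
      omega
    | coe x =>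
      rcases Nat.even_or_odd x.pos with hx | hx
      · rw [crownPartition_even _ _ _ hx, WithTop.recTopCoe_coe, hdec, if_pos hx]
        omega
      · have := hodd x hx
        rw [crownPartition_odd _ _ _ hx, WithTop.recTopCoe_coe, hdec,
          if_neg (Nat.not_even_iff_odd.mpr hx)]
        omega

theorem IsEnrichedPartition.le_top {n : ℕ} {ω : WithTop (Crown n) → ℤ}
    {f : WithTop (Crown n) → ℕ} (hf : IsEnrichedPartition ω f) (z : WithTop (Crown n)) :
    f z ≤ f ⊤ := by
  rcases (_root_.le_top (a := z)).eq_or_lt with rfl | h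
  · exact le_rfl
  · have := hf z ⊤ h
    rw [enrichedKey_lt_iff] at this
    omega

theorem enrichedCount_crown {n : ℕ} (hn : 1 ≤ n) {ω : WithTop (Crown n) → ℤ}
    (hω : HasCanonicalSigns ω) (m : ℕ) :
    enrichedCount ω (2 * m) =
      2 ^ (2 * n + 1) * ∑ k ∈ Finset.range (m - 1), monotoneCount (Crown n) k := by
  classical
  let F : (WithTop (Crown n) → Bool) ×
      (Σ k : Fin (m - 1), {g : Crown n → Fin ((k : ℕ) + 1) // Monotone g}) →
      {f : WithTop (Crown n) → Fin (2 * m) // IsEnrichedPartition ω fun x => (f x : ℕ)} :=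
    fun s =>
      have h := isEnrichedPartition_crownPartition hω s.1 (k := s.2.1)
        (g := fun x => (s.2.2.1 x : ℕ)) s.2.2.2 (fun x => Nat.lt_succ_iff.mp (s.2.2.1 x).2)
      ⟨fun z => ⟨crownPartition s.1 s.2.1 (fun x => (s.2.2.1 x : ℕ)) z, by
        have h1 := h.le_top z
        have h2 := (s.1 ⊤).toNat_lt
        have h3 := s.2.1.2
        rw [crownPartition_top] at h1
        omega⟩, h⟩
  have hF : Function.Bijective F := by
    constructor
    · rintro ⟨ε, ⟨k, hk⟩, g, hg⟩ ⟨ε', ⟨k', hk'⟩, g', hg'⟩ h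
      have hv : crownPartition ε k (fun x => (g x : ℕ)) =
          crownPartition ε' k' (fun x => (g' x : ℕ)) :=
        funext fun z => congrArg Fin.val (congrFun (congrArg Subtype.val h) z)
      obtain ⟨rfl, rfl, hgg⟩ := crownPartition_injective hv
      obtain rfl : g = g' := funext fun x => Fin.ext (congrFun hgg x)
      rfl
    · rintro ⟨f, hf⟩
      obtain ⟨ε, g, hg, htop, hgk, hfe⟩ := exists_crownPartition_eq hn hω hf
      have := (f ⊤).2
      -- The bound `f ⊤ < 2 * m` amounts to `k + 1 < m`, hence the range `m - 1` for `k`.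
      refine ⟨⟨ε, ⟨((f ⊤ : ℕ) / 2 - 1), by omega⟩,
        fun x => ⟨g x, Nat.lt_succ_iff.mpr (hgk x)⟩, fun x y h => hg h⟩, ?_⟩
      apply Subtype.ext
      funext z
      exact Fin.ext (congrFun hfe z)
  rw [enrichedCount, ← Nat.card_congr (Equiv.ofBijective F hF), Nat.card_prod, Nat.card_sigma,
    Fin.sum_univ_eq_sum_range (fun k => Nat.card {g : Crown n → Fin (k + 1) // Monotone g}),
    Nat.card_eq_fintype_card, Fintype.card_fun, Fintype.card_bool, Crown.card_withTop]
  rfl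

/-! ### The order polytope -/

theorem natCast_mem_smul_orderPolytope {P : Type*} [PartialOrder P] {k : ℕ} (hk : k ≠ 0)
    (z : P → ℤ) :
    (fun i => (z i : ℝ)) ∈ (k : ℝ) • orderPolytope P ↔
      (∀ i, 0 ≤ z i ∧ z i ≤ k) ∧ Monotone z := by
  have hk' : (0 : ℝ) < k := by positivity
  rw [Set.mem_smul_set_iff_inv_smul_mem₀ hk'.ne']
  simp only [orderPolytope, Set.mem_ofPred_eq, Pi.smul_apply, smul_eq_mul, inv_mul_le_iff₀ hk',
    mul_one]
  refine and_congr (forall_congr' fun i => and_congr ?_ ?_) ?_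
  · rw [mul_nonneg_iff_of_pos_left (inv_pos.mpr hk')]
    exact Int.cast_nonneg_iff
  · exact_mod_cast Iff.rfl
  · refine forall_congr' fun i => forall_congr' fun j => imp_congr Iff.rfl ?_
    rw [mul_inv_cancel_left₀ hk'.ne']
    exact_mod_cast Iff.rfl

theorem ehrhartCount_orderPolytope {P : Type*} [PartialOrder P] {k : ℕ} (hk : k ≠ 0) :
    ehrhartCount (orderPolytope P) k = monotoneCount P k := by
  rw [ehrhartCount, monotoneCount, ← Nat.card_coe_set_eq]
  simp only [natCast_mem_smul_orderPolytope hk]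
  symm
  refine Nat.card_congr (Equiv.ofBijective
    (fun g => ⟨fun i => ((g.1 i : ℕ) : ℤ), ⟨fun i => ?_, fun i j h => ?_⟩⟩) ⟨?_, ?_⟩)
  · have := (g.1 i).2
    dsimp only
    omega
  · have : g.1 i ≤ g.1 j := g.2 h
    dsimp only
    exact_mod_cast this
  · intro g g' h
    apply Subtype.ext
    funext i
    have : ((g.1 i : ℕ) : ℤ) = (g'.1 i : ℕ) := congrFun (congrArg Subtype.val h) i
    exact Fin.ext (by exact_mod_cast this)
  · rintro ⟨z, hz, hm⟩
    refine ⟨⟨fun i => ⟨(z i).toNat, by have := hz i; omega⟩, fun i j h => ?_⟩, ?_⟩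
    · exact Int.toNat_le_toNat (hm h)
    · apply Subtype.ext
      funext i
      exact Int.toNat_of_nonneg (hz i).1

theorem monotoneCount_zero (P : Type*) [PartialOrder P] : monotoneCount P 0 = 1 := by
  rw [monotoneCount, Nat.card_eq_one_iff_unique]
  have : Subsingleton (Fin (0 + 1)) := inferInstanceAs (Subsingleton (Fin 1))
  exact ⟨inferInstance, ⟨⟨fun _ => 0, monotone_const⟩⟩⟩

theorem ehrhartSeries_orderPolytope (P : Type*) [PartialOrder P] :
    ehrhartSeries (orderPolytope P) = PowerSeries.mk fun k => (monotoneCount P k : ℤ) := by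
  rw [ehrhartSeries]
  congr 1
  funext k
  split_ifs with hk
  · rw [hk, monotoneCount_zero, Nat.cast_one]
  · rw [ehrhartCount_orderPolytope hk]

theorem indicator_mem_orderPolytope {P : Type*} [PartialOrder P] {s : Set P} (hs : IsUpperSet s) :
    s.indicator 1 ∈ orderPolytope P := by
  classical
  refine ⟨fun i => ?_, fun i j hij => ?_⟩
  · rw [Set.indicator_apply]
    split_ifs <;> simp
  · rw [Set.indicator_apply, Set.indicator_apply]
    split_ifs with h1 h2
    · exact le_rfl
    · exact absurd (hs hij h1) h2
    · simp
    · exact le_rfl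

/-- Each standard basis vector is a difference of two points of the polytope, the indicators of the
up-sets `Set.Ici x` and `Set.Ioi x`. -/
theorem polytopeDim_orderPolytope (P : Type*) [Fintype P] [PartialOrder P] :
    polytopeDim (orderPolytope P) = Fintype.card P := by
  classical
  have htop : vectorSpan ℝ (orderPolytope P) = ⊤ := by
    rw [eq_top_iff, ← (Pi.basisFun ℝ P).span_eq, Submodule.span_le]
    rintro _ ⟨x, rfl⟩
    have h : Pi.basisFun ℝ P x = (Set.Ici x).indicator (1 : P → ℝ) -ᵥ
        (Set.Ioi x).indicator (1 : P → ℝ) := by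
      funext y
      rw [Pi.basisFun_apply, vsub_eq_sub, Pi.sub_apply, Set.indicator_apply, Set.indicator_apply,
        Pi.single_apply]
      simp only [Set.mem_Ici, Set.mem_Ioi, Pi.one_apply]
      rcases eq_or_ne y x with rfl | hne
      · simp
      · simp [hne, lt_iff_le_and_ne, hne.symm]
    rw [h]
    exact vsub_mem_vectorSpan ℝ (indicator_mem_orderPolytope (isUpperSet_Ici x))
      (indicator_mem_orderPolytope (isUpperSet_Ioi x))
  rw [polytopeDim, htop, finrank_top, Module.finrank_fintype_fun_eq_card]

/-! ### The `γ`-expansion -/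

theorem PowerSeries.charZero_int : CharZero (PowerSeries ℤ) :=
  charZero_of_injective_ringHom (f := PowerSeries.C) PowerSeries.C_injective

open PowerSeries in
theorem mk_sum_range_sub_one (u : ℕ → ℤ) :
    (PowerSeries.mk fun m => ∑ k ∈ Finset.range (m - 1), u k) * (1 - X) =
      X ^ 2 * PowerSeries.mk u := by
  ext m
  rw [mul_sub, mul_one, map_sub, pow_two, mul_assoc]
  rcases m with _ | _ | m
  · simp
  · rw [PowerSeries.coeff_succ_mul_X, PowerSeries.coeff_succ_X_mul]
    simp
  · rw [PowerSeries.coeff_succ_mul_X, PowerSeries.coeff_succ_X_mul, PowerSeries.coeff_succ_X_mul]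
    simp [Finset.sum_range_succ]

open PowerSeries in
theorem ehrhartSeries_crown_eq_sum {n : ℕ} (hn : 1 ≤ n) {ω : WithTop (Crown n) → ℤ}
    (hinj : Function.Injective ω) (hω : HasCanonicalSigns ω) :
    4 ^ n * (ehrhartSeries (orderPolytope (Crown n)) * (1 - X) ^ (2 * n + 1)) =
      ∑ j ∈ Finset.range n, (Set.ncard {a ∈ jordanHolder ω | peak a = j + 1} : ℤ⟦X⟧) *
        4 ^ (j + 1) * X ^ j * (1 + X) ^ (2 * n - 2 - 2 * j) := by
  have h := enrichedCount_series (Crown.card_withTop n) hinj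
  have hE : (PowerSeries.mk fun m => (enrichedCount ω (2 * m) : ℤ)) * (1 - X) =
      2 ^ (2 * n + 1) * (X ^ 2 * ehrhartSeries (orderPolytope (Crown n))) := by
    rw [ehrhartSeries_orderPolytope, ← mk_sum_range_sub_one, ← mul_assoc]
    congr 1
    ext m
    rw [show (2 ^ (2 * n + 1) : ℤ⟦X⟧) = PowerSeries.C (2 ^ (2 * n + 1)) by simp,
      PowerSeries.coeff_C_mul, PowerSeries.coeff_mk, PowerSeries.coeff_mk,
      enrichedCount_crown hn hω]
    push_cast
    rfl
  rw [pow_succ', ← mul_assoc, hE, Nat.mul_div_cancel_left n two_pos] at h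
  set N : ℕ → ℤ⟦X⟧ := fun j => (Set.ncard {a ∈ jordanHolder ω | peak a = j} : ℤ⟦X⟧) with hN
  set H := ehrhartSeries (orderPolytope (Crown n)) * (1 - X) ^ (2 * n + 1) with hH
  have := PowerSeries.charZero_int
  have h2X : (2 * X : ℤ⟦X⟧) ≠ 0 := mul_ne_zero two_ne_zero X_ne_zero
  have h1 : 4 ^ n * (X * H) =
      ∑ j ∈ Finset.range (n + 1), N j * ((4 * X) ^ j * (1 + X) ^ (2 * n - 2 * j)) := by
    refine mul_left_cancel₀ h2X ?_
    rw [Finset.mul_sum]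
    calc _ = 2 ^ (2 * n + 1) * (X ^ 2 * ehrhartSeries (orderPolytope (Crown n))) *
          (1 - X) ^ (2 * n + 1) := by
          rw [hH, pow_succ 2, pow_mul]
          ring
      _ = _ := h.trans (Finset.sum_congr rfl fun j _ => by ring)
  -- Compare constant terms: the left side is divisible by `X`, and on the right only `j = 0`
  -- survives, contributing `N 0`.
  have h0 : N 0 = 0 := by
    have := congrArg PowerSeries.constantCoeff h1
    rw [Finset.sum_range_succ', map_add, map_sum, Finset.sum_eq_zero] at this
    · simp only [map_mul, map_pow, PowerSeries.constantCoeff_X, zero_mul, mul_zero, pow_zero,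
        one_mul, map_add, map_one, add_zero, one_pow, mul_one, zero_add, hN, map_natCast] at this
      simp only [hN]
      have h3 := this.symm
      rw [Nat.cast_eq_zero] at h3
      rw [h3, Nat.cast_zero]
    · intro j _
      simp
  refine mul_left_cancel₀ (X_ne_zero (R := ℤ)) ?_
  rw [Finset.sum_range_succ', h0, zero_mul, add_zero] at h1
  rw [Finset.mul_sum]
  calc _ = 4 ^ n * (X * H) := by ring
    _ = _ := h1.trans (Finset.sum_congr rfl fun j _ => by
      rw [show 2 * n - 2 * (j + 1) = 2 * n - 2 - 2 * j by omega]
      ring)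

theorem gammaSum_natDegree_le (n : ℕ) (γ : ℕ → ℤ) :
    (∑ j ∈ Finset.range n, Polynomial.C (γ j) * Polynomial.X ^ j *
      (1 + Polynomial.X) ^ (2 * n - 2 - 2 * j)).natDegree ≤ 2 * n := by
  refine Polynomial.natDegree_sum_le_of_forall_le _ _ fun j hj => ?_
  rw [Finset.mem_range] at hj
  refine (Polynomial.natDegree_mul_le_of_le (Polynomial.natDegree_C_mul_X_pow_le _ _)
    (Polynomial.natDegree_pow_le_of_le _ (show (1 + Polynomial.X : Polynomial ℤ).natDegree ≤ 1 by
      compute_degree))).trans ?_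
  omega

/-- The expansion of `4 ^ n` times the `h^*`-polynomial by numbers of peaks. -/
theorem coe_peakSum {n : ℕ} (hn : 1 ≤ n) {ω : WithTop (Crown n) → ℤ}
    (hinj : Function.Injective ω) (hω : HasCanonicalSigns ω) :
    ((∑ j ∈ Finset.range n, Polynomial.C
      ((Set.ncard {a ∈ jordanHolder ω | peak a = j + 1} : ℤ) * 4 ^ (j + 1)) * Polynomial.X ^ j *
        (1 + Polynomial.X) ^ (2 * n - 2 - 2 * j) : Polynomial ℤ) : PowerSeries ℤ) =
      4 ^ n * (ehrhartSeries (orderPolytope (Crown n)) * (1 - PowerSeries.X) ^ (2 * n + 1)) := by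
  rw [ehrhartSeries_crown_eq_sum hn hinj hω, ← Polynomial.coeToPowerSeries.ringHom_apply, map_sum]
  refine Finset.sum_congr rfl fun j _ => ?_
  simp only [map_mul, map_pow, map_natCast, map_ofNat, map_add, map_one,
    Polynomial.coeToPowerSeries.ringHom_apply, Polynomial.coe_X]

theorem mainTheorem5 (n : ℕ) (hn : 1 ≤ n) :
    (∃ ω : WithTop (Crown n) → ℤ, IsCanonicalLabeling ω) ∧
    ∃ γ : ℕ → ℕ,
      IsHStarPolynomial (orderPolytope (Crown n))
        (∑ j ∈ Finset.range n,
          Polynomial.C (γ j : ℤ) * Polynomial.X ^ j *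
            (1 + Polynomial.X) ^ (2 * n - 2 - 2 * j)) ∧
      ∀ ω : WithTop (Crown n) → ℤ, IsCanonicalLabeling ω →
        ∀ j < n, (γ j : ℚ) =
          (2 : ℚ) ^ (-2 * (n : ℤ) + 2 + 2 * (j : ℤ)) *
            (Set.ncard {a ∈ jordanHolder ω | peak a = j + 1} : ℚ) := by
  have hcan := isCanonicalLabeling_crownLabeling hn
  refine ⟨⟨_, hcan⟩, ?_⟩
  have h0 := coe_peakSum hn hcan.1 hcan.hasCanonicalSigns
  have hdvd : ∀ j < n, (4 ^ n : ℤ) ∣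
      (Set.ncard {a ∈ jordanHolder (crownLabeling n) | peak a = j + 1} : ℤ) * 4 ^ (j + 1) := by
    refine dvd_of_forall_dvd_coeff_sum _ (fun j => 2 * n - 2 - 2 * j) _ fun k => ?_
    rw [← Polynomial.coeff_coe, h0, show (4 ^ n : PowerSeries ℤ) = PowerSeries.C (4 ^ n) by simp,
      PowerSeries.coeff_C_mul]
    exact dvd_mul_right _ _
  -- The quotients are natural numbers because the peak counts are; indices from `n` on get the
  -- irrelevant value `0`.
  have hγ : ∀ j, ∃ g : ℕ, j < n →
      (Set.ncard {a ∈ jordanHolder (crownLabeling n) | peak a = j + 1} : ℤ) * 4 ^ (j + 1) =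
        4 ^ n * g := by
    intro j
    by_cases hj : j < n
    · have := hdvd j hj
      have h' : 4 ^ n ∣
        Set.ncard {a ∈ jordanHolder (crownLabeling n) | peak a = j + 1} * 4 ^ (j + 1) := by
        exact_mod_cast this
      obtain ⟨g, hg⟩ := h'
      exact ⟨g, fun _ => by exact_mod_cast hg⟩
    · exact ⟨0, fun h => absurd h hj⟩
  choose γ hγ using hγ
  have := PowerSeries.charZero_int
  have hdim : polytopeDim (orderPolytope (Crown n)) = 2 * n := by
    rw [polytopeDim_orderPolytope]
    exact Fintype.card_fin (2 * n)
  refine ⟨γ, ⟨?_, ?_⟩, fun ω hω j hj => ?_⟩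
  · rw [hdim]
    exact gammaSum_natDegree_le n fun j => (γ j : ℤ)
  · rw [hdim]
    refine mul_left_cancel₀ (pow_ne_zero n (OfNat.ofNat_ne_zero 4 : (4 : PowerSeries ℤ) ≠ 0)) ?_
    rw [← h0, show (4 ^ n : PowerSeries ℤ) = ((Polynomial.C (4 ^ n) : Polynomial ℤ) :
      PowerSeries ℤ) by rw [Polynomial.coe_C]; simp, ← Polynomial.coe_mul, Finset.mul_sum]
    congr 1
    refine Finset.sum_congr rfl fun j hj => ?_
    rw [hγ j (Finset.mem_range.mp hj), Polynomial.C_mul]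
    ring
  · have h1 := coe_peakSum hn hω.1 hω.hasCanonicalSigns
    have h2 := Polynomial.coe_injective ℤ (h1.trans h0.symm)
    -- Both labelings expand the same polynomial, so the difference of the coefficients is divisible
    -- by `0`, hence zero.
    have h3 := dvd_of_forall_dvd_coeff_sum (n := n) (fun j =>
      (Set.ncard {a ∈ jordanHolder ω | peak a = j + 1} : ℤ) * 4 ^ (j + 1) -
      (Set.ncard {a ∈ jordanHolder (crownLabeling n) | peak a = j + 1} : ℤ) * 4 ^ (j + 1))
      (fun j => 2 * n - 2 - 2 * j) 0 (fun k => by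
        simp only [Polynomial.C_sub, sub_mul, Finset.sum_sub_distrib]
        rw [h2, sub_self, Polynomial.coeff_zero]) j hj
    rw [zero_dvd_iff, sub_eq_zero, hγ j hj] at h3
    have h4 : (Set.ncard {a ∈ jordanHolder ω | peak a = j + 1} : ℚ) * 4 ^ (j + 1) =
        4 ^ n * γ j := by exact_mod_cast h3
    have h5 : (2 : ℚ) ^ (-2 * (n : ℤ) + 2 + 2 * (j : ℤ)) * 4 ^ n = 4 ^ (j + 1) := by
      rw [show (4 : ℚ) = 2 ^ (2 : ℤ) by norm_num, ← zpow_natCast, ← zpow_natCast, ← zpow_mul,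
        ← zpow_mul, ← zpow_add₀ two_ne_zero]
      congr 1
      push_cast
      ring
    refine mul_left_cancel₀ (pow_ne_zero n (four_ne_zero : (4 : ℚ) ≠ 0)) ?_
    rw [← h4, ← h5]
    ring
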